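/- **Theorem (Unlimited Sampling Theorem).** Let $\lambda>0$ and $T>0$. For $x\in\mathbb R$ let $\mathscr M_\lambda(x)=2\lambda\left(\left\{\tfrac{x}{2\lambda}+\tfrac12\right\}-\tfrac12\right)$, where $\{u\}=u-\lfloor u\rfloor$. A function $g:\mathbb R\to\mathbb R$ is called $\pi$-bandlimited if it is continuous, belongs to $L^2(\mathbb R)$, and its $L^2$ Fourier transform $\widehat g(\omega)=\int g(t)e^{-i\omega t}\,dt$ vanishes for almost every $\omega$ outside $[-\pi,\pi]$. Write $\|g\|_\infty=\sup_t|g(t)|$, and let $y_k=\mathscr M_\lambda(g(kT))$, $k\in\mathbb Z$, be the modulo samples of $g$. Assume $T\le \frac1{2\pi e}$. Then: (1) Every $\pi$-bandlimited $g$ can be recovered from $\{y_k\}_{k\in\mathbb Z}$ up to an additive multiple of $2\lambda$: there is a map $R:\mathbb R^{\mathbb Z}\to\mathbb R^{\mathbb R}$, depending only on $\lambda$ and $T$, such that for every $\pi$-bandlimited $g$ there is $m\in\mathbb Z$ with $R\big((y_k)_k\big)(t)=g(t)+2\lambda m$ for all $t\in\mathbb R$. (2) Let $g$ be $\pi$-bandlimited,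 let $\beta_g\in2\lambda\mathbb Z$, $\beta_g>0$, satisfy $\|g\|_\infty\le\beta_g$, and let $$N=\left\lceil\frac{\log\lambda-\log\beta_g}{\log(T\pi e)}\right\rceil .$$ Then $(T\pi e)^N\|g\|_\infty\le\lambda$, and $(T\pi e)^N\|g\|_\infty<\lambda$ unless both $\|g\|_\infty=\beta_g$ and $(T\pi e)^N\beta_g=\lambda$. Moreover, in all cases, the algorithm below recovers $g$ from $y=(y_k)_k$ up to an additive multiple of $2\lambda$: there is $m\in\mathbb Z$ such that $\widetilde\gamma_k=g(kT)+2\lambda m$ for all $k\in\mathbb Z$ and $\widetilde g(t)=g(t)+2\lambda m$ for all $t\in\mathbb R$, for each cutoff frequency $\Omega\in[\pi,\pi/T]$ of the low-pass filter in step 4 (in particular, the limit there exists). **Algorithm.** For $a\in\mathbb R^{\mathbb Z}$ let $(\Delta a)_k=a_{k+1}-a_k$, and let $\mathsf S$ be the inverse of $\Delta$ normalised by $(\mathsf Sa)_1=0$, i.e. $(\mathsf Sa)_i=\sum_{j=1}^{i-1}a_j$ for $i\ge1$ and $(\mathsf Sa)_i=-\sum_{j=i}^{0}a_j$ for $i\le0$.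 Put $J=6\beta_g/\lambda\in\mathbb Z$. 1. Compute $\bar y=\Delta^Ny$ and set $s_{(1)}=\mathscr M_\lambda(\bar y)-\bar y$. 2. For $n=1,\dots,N-1$: compute $$\kappa_{(n)}=\left\lfloor\frac{(\mathsf S^2s_{(n)})_1-(\mathsf S^2s_{(n)})_{J+1}}{12\beta_g}+\frac12\right\rfloor$$ and set $s_{(n+1)}=\mathsf Ss_{(n)}+2\lambda\kappa_{(n)}$. 3. Set $\widetilde\gamma=\mathsf Ss_{(N)}+y$. 4. Apply the ideal low-pass filter with cutoff $\Omega$: $$\widetilde g(t)=\lim_{K\to\infty}\sum_{k=-K}^{K}\widetilde\gamma_k\,\frac{T\sin(\Omega(t-kT))}{\pi(t-kT)},$$ where the quotient is read as $T\Omega/\pi$ when $t=kT$. -/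

import Mathlib

open MeasureTheory Filter Topology FourierTransform
open scoped ENNReal

noncomputable section

namespace UnlimitedSampling

/-- `g : ℝ → ℝ` is `Ω`-bandlimited: it is square integrable and its `L²` Fourier transform vanishes
almost everywhere outside `[-Ω, Ω]`. Mathlib's transform uses the kernel `exp (-2πiξt)`, so the
angular frequency belonging to `ξ` is `2πξ`. Point samples of `g` refer to its continuous
representative. -/
structure IsBandlimited (Ω : ℝ) (g : ℝ → ℝ) : Prop where
  continuous : Continuous g
  memLp : MemLp (fun t => (g t : ℂ)) 2 volume
  fourier_eq_zero :
    ∀ᵐ ξ : ℝ, Ω < |2 * Real.pi * ξ| →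
      (𝓕 (MemLp.toLp (μ := volume) (fun t => (g t : ℂ)) memLp) : Lp (α := ℝ) ℂ 2 volume) ξ = 0

/-- The supremum norm of `g`, as an extended nonnegative real. -/
def supNorm (g : ℝ → ℝ) : ℝ≥0∞ := ⨆ t : ℝ, ‖g t‖ₑ

/-- The centred modulo map `x ↦ 2λ (⟦x / (2λ) + 1/2⟧ - 1/2)`, `⟦·⟧` being the fractional part. -/
def fold (lam : ℝ) (x : ℝ) : ℝ := 2 * lam * (Int.fract (x / (2 * lam) + 1 / 2) - 1 / 2)

/-- The modulo samples `y_k` of `g` with sampling step `T`. -/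
def moduloSamples (lam T : ℝ) (g : ℝ → ℝ) : ℤ → ℝ := fun k => fold lam (g (k * T))

/-- The summation operator `S` on two-sided sequences: the inverse of the forward difference
normalised by `(S a) 1 = 0`, i.e. `(S a) i = a 1 + ⋯ + a (i - 1)` for `1 ≤ i` and
`(S a) i = -(a i + ⋯ + a 0)` for `i ≤ 0`. -/
def summation (a : ℤ → ℝ) : ℤ → ℝ := fun i =>
  ∑ j ∈ Finset.Ico 1 i, a j - ∑ j ∈ Finset.Ico i 1, a j

theorem summation_one (a : ℤ → ℝ) : summation a 1 = 0 := by
  simp [summation]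

theorem fwdDiff_summation (a : ℤ → ℝ) : fwdDiff (1 : ℤ) (summation a) = a := by
  funext i
  unfold fwdDiff summation
  rcases le_or_gt 1 i with h | h
  · rw [← Finset.insert_Ico_right_eq_Ico_add_one h, Finset.sum_insert (by simp),
      Finset.Ico_eq_empty (a := i) (by omega), Finset.Ico_eq_empty (a := i + 1) (by omega)]
    simp
  · rw [← Finset.insert_Ico_add_one_left_eq_Ico h, Finset.sum_insert (by simp),
      Finset.Ico_eq_empty (a := 1) (b := i) (by omega),
      Finset.Ico_eq_empty (a := 1) (b := i + 1) (by omega)]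
    simp

/-- The integer `κ` computed from the current sequence `s`, where `J = 6β/λ` (an integer when
`β ∈ 2λℤ`). Note that `2λJ = 12β`. -/
def kappa (lam beta : ℝ) (s : ℤ → ℝ) : ℤ :=
  ⌊(summation (summation s) 1 - summation (summation s) (⌊6 * beta / lam⌋ + 1)) / (12 * beta)
    + 1 / 2⌋

/-- One pass through the loop of the algorithm: `s ↦ S s + 2λκ`. -/
def algorithmStep (lam beta : ℝ) (s : ℤ → ℝ) : ℤ → ℝ := fun k =>
  summation s k + 2 * lam * kappa lam beta s

/-- The initial sequence `s₍₁₎ = M_λ(Δ^N y) - Δ^N y` of the algorithm. -/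
def algorithmInit (lam : ℝ) (N : ℕ) (y : ℤ → ℝ) : ℤ → ℝ := fun k =>
  fold lam ((fwdDiff (1 : ℤ))^[N] y k) - (fwdDiff (1 : ℤ))^[N] y k

/-- The sequence of unfolded samples computed by the algorithm from the data `λ, β, N, y`:
`γ̃ = S s₍N₎ + y`, with `s₍N₎` obtained from `s₍₁₎` by `N - 1` passes through the loop. -/
def recoveredSamples (lam beta : ℝ) (N : ℕ) (y : ℤ → ℝ) : ℤ → ℝ := fun k =>
  summation ((algorithmStep lam beta)^[N - 1] (algorithmInit lam N y)) k + y k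

/-- `f` is the output of the ideal low-pass filter with cutoff `Ω` and gain `T`, whose impulse
response is `u ↦ T sin (Ωu) / (πu)`, on the impulse train `∑ a_k δ(t - kT)`; the series is summed
symmetrically. -/
def IsLowPassOutput (T Ω : ℝ) (a : ℤ → ℝ) (f : ℝ → ℝ) : Prop :=
  ∀ t : ℝ, Tendsto
    (fun K : ℕ => ∑ k ∈ Finset.Icc (-(K : ℤ)) K,
      a k * (T * Ω / Real.pi * Real.sinc (Ω * (t - k * T))))
    atTop (𝓝 (f t))

end UnlimitedSampling

end

namespace UnlimitedSampling

/-! Write γ_k = g(kT) and e = γ - y, a sequence with values in 2λℤ. Bernstein's inequality gives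
|Δⁿγ| ≤ (πT)ⁿ‖g‖∞. For n = N this is strictly below λ: it lacks the factor e^N of (Tπe)^N, which is
why the borderline case of (2) causes no trouble. As Δ^N e takes values in 2λℤ, folding Δ^N y
returns Δ^N γ, so Δ^N e is known exactly.

Each summation then loses one constant, a multiple of 2λ. While Δ^p e (p ≤ N - 2) is bounded by
3β/2, a unit error in the constant of Δ^(p+1) e makes its sum drift by 2λJ = 12β over J steps;
rounding therefore identifies the constant (`kappa_fwdDiff_fwdDiff`). Only the constant of the last
summation stays unknown, which is the ambiguity 2λm.

Bernstein's inequality (`HasSpectrum.norm_sub_le`) comes from M. Riesz' formula, which writes the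
derivative as an absolutely convergent combination of translates. The filter reproduces g by
Parseval (`HasSpectrum.hasSum_lowPass`). The added constant is not square integrable, so it needs a
separate telescoping argument (`tendsto_sum_lowPass`).

For (1), two bandlimited functions with equal samples are run through the algorithm with a common β,
so they differ by a multiple of 2λ; R selects any function with the given samples. -/

/-! ### Folding, summation and the unfolding loop -/

theorem fold_eq_sub (lam : ℝ) (hlam : 0 < lam) (x : ℝ) :
    fold lam x = x - 2 * lam * ⌊x / (2 * lam) + 1 / 2⌋ := by
  unfold fold Int.fract
  field_simp
  ring

theorem abs_fold_le (lam : ℝ) (hlam : 0 < lam) (x : ℝ) : |fold lam x| ≤ lam := by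
  unfold fold
  have h0 := Int.fract_nonneg (x / (2 * lam) + 1 / 2)
  have h1 := (Int.fract_lt_one (x / (2 * lam) + 1 / 2)).le
  rw [abs_le]
  constructor <;> nlinarith

theorem fold_sub_two_mul_int (lam : ℝ) (hlam : 0 < lam) (x : ℝ) (n : ℤ) :
    fold lam (x - 2 * lam * n) = fold lam x := by
  unfold fold
  have : (x - 2 * lam * n) / (2 * lam) + 1 / 2 = x / (2 * lam) + 1 / 2 - n := by
    field_simp; ring
  rw [this, Int.fract_sub_intCast]

theorem fold_eq_self (lam : ℝ) (x : ℝ) (hx : |x| < lam) : fold lam x = x := by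
  have hlam : 0 < lam := (abs_nonneg x).trans_lt hx
  rw [abs_lt] at hx
  have : ⌊x / (2 * lam) + 1 / 2⌋ = 0 := by
    rw [Int.floor_eq_zero_iff]
    constructor
    · have : -(1 / 2) ≤ x / (2 * lam) := by
        rw [le_div_iff₀ (by positivity)]; linarith
      linarith
    · have : x / (2 * lam) < 1 / 2 := by
        rw [div_lt_iff₀ (by positivity)]; linarith
      linarith
  rw [fold_eq_sub lam hlam, this]
  simp

theorem summation_eq_of_fwdDiff_eq {a F : ℤ → ℝ} (h : fwdDiff (1 : ℤ) F = a) (h1 : F 1 = 0) :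
    summation a = F := by
  have key : ∀ i, summation a (i + 1) - F (i + 1) = summation a i - F i := by
    intro i
    have e1 := congrFun (fwdDiff_summation a) i
    have e2 := congrFun h i
    simp only [fwdDiff] at e1 e2
    linarith
  funext i
  suffices summation a i - F i = 0 by linarith
  induction i using Int.inductionOn' (b := 1) with
  | zero => simp [summation_one, h1]
  | succ k _ ih => rw [key, ih]
  | pred k _ ih => rw [← key, sub_add_cancel, ih]

theorem summation_fwdDiff (a : ℤ → ℝ) :
    summation (fwdDiff (1 : ℤ) a) = fun i => a i - a 1 :=
  summation_eq_of_fwdDiff_eq (by funext i; simp [fwdDiff]) (by simp)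

/-- Double summation loses an affine function; its slope is the constant that `kappa` has to find.
-/
theorem summation_summation_fwdDiff_fwdDiff (c : ℤ → ℝ) (i : ℤ) :
    summation (summation (fwdDiff (1 : ℤ) (fwdDiff (1 : ℤ) c))) i =
      c i - c 1 - fwdDiff (1 : ℤ) c 1 * (i - 1) := by
  rw [summation_fwdDiff, summation_eq_of_fwdDiff_eq
    (F := fun i : ℤ => c i - c 1 - fwdDiff (1 : ℤ) c 1 * ((i : ℝ) - 1))]
  · funext i
    simp only [fwdDiff]
    push_cast
    ring
  · simp

theorem iterate_fwdDiff_mul_intCast (x : ℝ) (E : ℤ → ℤ) (n : ℕ) :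
    (fwdDiff (1 : ℤ))^[n] (fun k => x * (E k : ℝ)) =
      fun k => x * (((fwdDiff (1 : ℤ))^[n] E k : ℤ) : ℝ) := by
  induction n with
  | zero => rfl
  | succ n ih =>
    rw [Function.iterate_succ_apply', ih, Function.iterate_succ_apply']
    funext k
    simp only [fwdDiff]
    push_cast
    ring

theorem iterate_fwdDiff_sub (a b : ℤ → ℝ) (n : ℕ) :
    (fwdDiff (1 : ℤ))^[n] (fun k => a k - b k) =
      fun k => (fwdDiff (1 : ℤ))^[n] a k - (fwdDiff (1 : ℤ))^[n] b k := by
  induction n with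
  | zero => rfl
  | succ n ih =>
    simp only [Function.iterate_succ_apply', ih]
    funext k
    simp only [fwdDiff]
    ring

theorem abs_iterate_fwdDiff_le (a : ℤ → ℝ) {C : ℝ} (h : ∀ k, |a k| ≤ C) (n : ℕ) (k : ℤ) :
    |(fwdDiff (1 : ℤ))^[n] a k| ≤ 2 ^ n * C := by
  induction n generalizing k with
  | zero => simpa using h k
  | succ n ih =>
    rw [Function.iterate_succ_apply', fwdDiff]
    calc _ ≤ _ := abs_sub _ _
      _ ≤ 2 ^ n * C + 2 ^ n * C := add_le_add (ih _) (ih _)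
      _ = _ := by ring

/-- Over J = 12b steps the slope 2λm contributes 2λmJ = 12βm, while c itself changes by at most 3β.
After division by 12β the error is at most 1/4, so rounding gives m. -/
theorem kappa_fwdDiff_fwdDiff {lam beta : ℝ} (hlam : 0 < lam) (hbeta : 0 < beta) {b : ℤ}
    (hb : beta = 2 * lam * b) (c : ℤ → ℝ) (hc : ∀ k, |c k| ≤ 3 / 2 * beta) {m : ℤ}
    (hm : fwdDiff (1 : ℤ) c 1 = 2 * lam * m) :
    kappa lam beta (fwdDiff (1 : ℤ) (fwdDiff (1 : ℤ) c)) = m := by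
  have hJ : ⌊6 * beta / lam⌋ = 12 * b := by
    have : 6 * beta / lam = ((12 * b : ℤ) : ℝ) := by
      rw [hb]; push_cast; field_simp; ring
    rw [this, Int.floor_intCast]
  unfold kappa
  rw [summation_summation_fwdDiff_fwdDiff, summation_summation_fwdDiff_fwdDiff, hJ, hm]
  have e : (c 1 - c 1 - 2 * lam * m * (((1 : ℤ) : ℝ) - 1) -
      (c (12 * b + 1) - c 1 - 2 * lam * m * (((12 * b + 1 : ℤ) : ℝ) - 1))) / (12 * beta) + 1 / 2
      = (c 1 - c (12 * b + 1)) / (12 * beta) + 1 / 2 + m := by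
    have : (b : ℝ) * (2 * lam) = beta := by rw [hb]; ring
    field_simp
    push_cast
    linear_combination (24 * (m : ℝ)) * this
  rw [e, Int.floor_add_intCast]
  have h1 := abs_le.1 (hc 1)
  have h2 := abs_le.1 (hc (12 * b + 1))
  have : ⌊(c 1 - c (12 * b + 1)) / (12 * beta) + 1 / 2⌋ = 0 := by
    rw [Int.floor_eq_zero_iff]
    constructor
    · have : -(1 / 2) ≤ (c 1 - c (12 * b + 1)) / (12 * beta) := by
        rw [le_div_iff₀ (by positivity)]; linarith
      linarith
    · have : (c 1 - c (12 * b + 1)) / (12 * beta) < 1 / 2 := by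
        rw [div_lt_iff₀ (by positivity)]; linarith
      linarith
  rw [this, zero_add]

/-- The algorithm unfolds every sequence whose differences of order at most `N` are bounded by
`beta` and whose differences of order `N` are smaller than `lam`. -/
theorem exists_recoveredSamples_eq {lam beta : ℝ} (hlam : 0 < lam) (hbeta : 0 < beta) {b : ℤ}
    (hb : beta = 2 * lam * b) {N : ℕ} (hN : 1 ≤ N) (hN2 : 2 ^ (N - 1) * lam ≤ beta)
    (γ : ℤ → ℝ) (hγ : ∀ n k, |(fwdDiff (1 : ℤ))^[n] γ k| ≤ beta)
    (hγN : ∀ k, |(fwdDiff (1 : ℤ))^[N] γ k| < lam) :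
    ∃ m : ℤ, ∀ k, recoveredSamples lam beta N (fun k => fold lam (γ k)) k = γ k + 2 * lam * m := by
  set y : ℤ → ℝ := fun k => fold lam (γ k) with hy
  set E : ℤ → ℤ := fun k => ⌊γ k / (2 * lam) + 1 / 2⌋ with hE
  set e : ℤ → ℝ := fun k => 2 * lam * (E k : ℝ) with he
  have hey : (fun k => γ k - y k) = e := by
    funext k
    simp only [hy, he, hE, fold_eq_sub lam hlam]
    ring
  have hye : y = fun k => γ k - e k := by rw [← hey]; funext k; ring
  have heE : ∀ n k, (fwdDiff (1 : ℤ))^[n] e k =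
      2 * lam * (((fwdDiff (1 : ℤ))^[n] E k : ℤ) : ℝ) := fun n k => by
    rw [he, iterate_fwdDiff_mul_intCast]
  -- Δ^N y and Δ^N γ differ by multiples of 2λ, and Δ^N γ already lies in (-λ, λ), where folding is
  -- the identity.
  have hinit : algorithmInit lam N y = (fwdDiff (1 : ℤ))^[N] e := by
    funext k
    unfold algorithmInit
    rw [hye, iterate_fwdDiff_sub]
    simp only [heE]
    rw [fold_sub_two_mul_int lam hlam, fold_eq_self _ _ (hγN k)]
    ring
  -- |Δ^p e| ≤ |Δ^p γ| + |Δ^p y| ≤ β + 2^p λ, and 2^p λ ≤ β/2 because p ≤ N - 2.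
  have hbound : ∀ p, p + 2 ≤ N → ∀ k, |(fwdDiff (1 : ℤ))^[p] e k| ≤ 3 / 2 * beta := by
    intro p hp k
    rw [← hey, iterate_fwdDiff_sub]
    have h1 := abs_iterate_fwdDiff_le y (fun k => abs_fold_le lam hlam (γ k)) p k
    have h2 : (2 : ℝ) ^ p * 2 ≤ 2 ^ (N - 1) := by
      rw [← pow_succ]
      exact pow_le_pow_right₀ (by norm_num) (by omega)
    have h3 := abs_sub ((fwdDiff (1 : ℤ))^[p] γ k) ((fwdDiff (1 : ℤ))^[p] y k)
    have h4 := hγ p k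
    nlinarith
  -- Loop invariant: each pass removes one difference, and 2λκ restores the value at index 1 that
  -- summation sets to zero.
  have hloop : ∀ j, j + 1 ≤ N →
      (algorithmStep lam beta)^[j] (algorithmInit lam N y) = (fwdDiff (1 : ℤ))^[N - j] e := by
    intro j hj
    induction j with
    | zero => simpa using hinit
    | succ j ih =>
      obtain ⟨p, hp⟩ : ∃ p, N = p + 2 + j := ⟨N - 2 - j, by omega⟩
      rw [Function.iterate_succ_apply', ih (by omega), show N - j = p + 1 + 1 by omega,
        show N - (j + 1) = p + 1 by omega, Function.iterate_succ_apply',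
        Function.iterate_succ_apply']
      have hm := heE (p + 1) 1
      rw [Function.iterate_succ_apply'] at hm
      funext k
      unfold algorithmStep
      rw [kappa_fwdDiff_fwdDiff hlam hbeta hb _ (hbound p (by omega)) hm, summation_fwdDiff, ← hm]
      ring
  -- The final summation has no correction and returns e - e_1, with e_1 = 2λ E_1.
  refine ⟨-E 1, fun k => ?_⟩
  unfold recoveredSamples
  rw [hloop (N - 1) (by omega), show N - (N - 1) = 1 by omega, Function.iterate_one,
    summation_fwdDiff, hye]
  simp only [he]
  push_cast
  ring

/-! ### The cosine series behind Riesz' formula -/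

theorem hasSum_cos_div_sq {x : ℝ} (hx : x ∈ Set.Icc (0 : ℝ) 1) :
    HasSum (fun n : ℕ => 1 / (n : ℝ) ^ 2 * Real.cos (2 * Real.pi * n * x))
      (Real.pi ^ 2 * (x ^ 2 - x + 6⁻¹)) := by
  have h := hasSum_one_div_nat_pow_mul_cos one_ne_zero hx
  have h2 : (Polynomial.map (algebraMap ℚ ℝ) (Polynomial.bernoulli (2 * 1))).eval x =
      x ^ 2 - x + 6⁻¹ := bernoulliFun_two x
  rw [h2] at h
  convert h using 1
  simp
  ring

/-- Subtracting the series at x + 1/2 from the one at x cancels the even frequencies and the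
quadratic term, leaving a linear function. The term n = 0 vanishes since division by zero gives 0.
-/
theorem hasSum_odd_cos_div_sq {x : ℝ} (hx : x ∈ Set.Icc (0 : ℝ) (1 / 2)) :
    HasSum (fun n : ℕ => (1 - (-1) ^ n) / (n : ℝ) ^ 2 * Real.cos (2 * Real.pi * n * x))
      (Real.pi ^ 2 * (1 / 4 - x)) := by
  have h1 := hasSum_cos_div_sq (x := x) ⟨hx.1, by linarith [hx.2]⟩
  have h2 := hasSum_cos_div_sq (x := x + 1 / 2) ⟨by linarith [hx.1], by linarith [hx.2]⟩
  convert! h1.sub h2 using 1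
  · funext n
    have : 2 * Real.pi * n * (x + 1 / 2) = 2 * Real.pi * n * x + n * Real.pi := by ring
    rw [this, Real.cos_add_nat_mul_pi]
    ring
  · ring

/-- The expansion behind M. Riesz' interpolation formula for the derivative. -/
theorem hasSum_riesz {ξ : ℝ} (hξ : |ξ| ≤ 1 / 2) :
    HasSum (fun n : ℕ => (1 - (-1) ^ n) / (n : ℝ) ^ 2 *
      Real.cos (Real.pi * n / 2 - Real.pi * n * ξ)) (Real.pi ^ 2 / 2 * ξ) := by
  rw [abs_le] at hξ
  have h := hasSum_odd_cos_div_sq (x := 1 / 4 - ξ / 2)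
    ⟨by linarith [hξ.2], by linarith [hξ.1]⟩
  convert h using 1
  · funext n
    ring_nf
  · ring

theorem hasSum_riesz_coeff :
    HasSum (fun n : ℕ => (1 - (-1) ^ n) / (n : ℝ) ^ 2) (Real.pi ^ 2 / 4) := by
  have h := hasSum_odd_cos_div_sq (x := 0) ⟨le_rfl, by norm_num⟩
  simpa [div_eq_mul_inv] using h

theorem riesz_coeff_nonneg (n : ℕ) : 0 ≤ (1 - (-1) ^ n) / (n : ℝ) ^ 2 := by
  apply div_nonneg _ (by positivity)
  rcases neg_one_pow_eq_or ℝ n with h | h <;> rw [h] <;> norm_num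

/-! ### Inverse Fourier representation of bandlimited functions -/

section Spectrum

open Complex

theorem norm_exp_two_pi_mul_I (x : ℝ) : ‖cexp (2 * Real.pi * x * I)‖ = 1 := by
  have : (2 * Real.pi * x * I : ℂ) = ((2 * Real.pi * x : ℝ) : ℂ) * I := by push_cast; ring
  rw [this, norm_exp_ofReal_mul_I]

theorem continuous_integral_exp_mul {G : ℝ → ℂ} (hG : Integrable G) :
    Continuous fun t : ℝ => ∫ ξ : ℝ, cexp (2 * Real.pi * (ξ * t : ℝ) * I) * G ξ := by
  refine continuous_of_dominated (bound := fun ξ => ‖G ξ‖) (fun t => ?_) (fun t => ?_) hG.norm ?_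
  · exact (Continuous.aestronglyMeasurable (by fun_prop)).mul hG.aestronglyMeasurable
  · exact .of_forall fun ξ => by rw [norm_mul, norm_exp_two_pi_mul_I, one_mul]
  · exact .of_forall fun ξ => by fun_prop

theorem integral_fourierInv_mul {φ G : ℝ → ℂ} (hφ : Integrable φ) (hG : Integrable G) :
    ∫ ξ : ℝ, 𝓕⁻ φ ξ * G ξ = ∫ t, φ t * ∫ ξ : ℝ, cexp (2 * Real.pi * (ξ * t : ℝ) * I) * G ξ := by
  have h1 : ∀ ξ, 𝓕⁻ φ ξ * G ξ = ∫ t : ℝ, φ t * (cexp (2 * Real.pi * (ξ * t : ℝ) * I) * G ξ) := by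
    intro ξ
    rw [Real.fourierInv_eq', ← integral_mul_const]
    congr 1
    funext t
    simp only [smul_eq_mul, RCLike.inner_apply, conj_trivial]
    push_cast
    ring
  simp_rw [h1, ← integral_const_mul]
  apply integral_integral_swap
  refine ((hG.mul_prod hφ).bdd_mul (c := 1)
    (f := fun p : ℝ × ℝ => cexp (2 * Real.pi * (p.1 * p.2 : ℝ) * I)) ?_ ?_).congr ?_
  · exact Continuous.aestronglyMeasurable (by fun_prop)
  · exact .of_forall fun p => (norm_exp_two_pi_mul_I _).le
  · exact .of_forall fun p => by simp only [Function.uncurry]; ring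

open SchwartzMap in
/-- A square integrable function with integrable Fourier transform is its inverse transform. -/
theorem ae_eq_integral_exp_mul_fourier (f : Lp (α := ℝ) ℂ 2 volume)
    (hf : Integrable (𝓕 f : Lp (α := ℝ) ℂ 2 volume)) :
    ∀ᵐ t, f t = ∫ ξ : ℝ, cexp (2 * Real.pi * (ξ * t : ℝ) * I) *
      (𝓕 f : Lp (α := ℝ) ℂ 2 volume) ξ := by
  -- Inversion holds for tempered distributions; testing against smooth compactly supported
  -- functions and applying Fubini turns it into an almost everywhere identity.
  have hinv := Lp.fourierInv_toTemperedDistribution_eq (𝓕 f : Lp (α := ℝ) ℂ 2 volume)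
  rw [fourierInv_fourier_eq] at hinv
  refine ae_eq_of_integral_contDiff_smul_eq ((Lp.memLp f).locallyIntegrable (by norm_num))
    (continuous_integral_exp_mul hf).locallyIntegrable fun φ hφ hφc => ?_
  have hφc' : HasCompactSupport (Complex.ofRealCLM ∘ φ) := hφc.comp_left rfl
  have hφ' : ContDiff ℝ (⊤ : ℕ∞) (Complex.ofRealCLM ∘ φ) := by fun_prop
  have h := DFunLike.congr_fun hinv (hφc'.toSchwartzMap hφ')
  rw [TemperedDistribution.fourierInv_apply, Lp.toTemperedDistribution_apply,
    Lp.toTemperedDistribution_apply, fourierInv_coe] at h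
  simp only [smul_eq_mul] at h
  rw [integral_fourierInv_mul (hφc'.toSchwartzMap hφ').integrable hf] at h
  simpa using h.symm

/-- `f` is the inverse Fourier transform of an integrable function supported in
`[-1/2, 1/2]`. -/
def HasSpectrum (G : ℝ → ℂ) (f : ℝ → ℂ) : Prop :=
  Integrable G ∧ (∀ ξ, 1 / 2 < |ξ| → G ξ = 0) ∧
    ∀ t : ℝ, f t = ∫ ξ : ℝ, Complex.exp (2 * Real.pi * (ξ * t : ℝ) * Complex.I) * G ξ

theorem IsBandlimited.exists_hasSpectrum {g : ℝ → ℝ} (hg : IsBandlimited Real.pi g) :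
    ∃ G : ℝ → ℂ, MemLp G 2 volume ∧ HasSpectrum G fun t => (g t : ℂ) := by
  set f := MemLp.toLp (μ := volume) (fun t => (g t : ℂ)) hg.memLp
  set F : Lp (α := ℝ) ℂ 2 volume := 𝓕 f with hF
  -- Angular frequency π corresponds to ξ = 1/2. Truncation makes the transform vanish everywhere
  -- outside the band and, being L² on a bounded interval, integrable.
  set G : ℝ → ℂ := (Set.Icc (-(1 / 2) : ℝ) (1 / 2)).indicator F with hG
  have hFG : F =ᵐ[volume] G := by
    filter_upwards [hg.fourier_eq_zero] with ξ hξ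
    by_cases h : ξ ∈ Set.Icc (-(1 / 2) : ℝ) (1 / 2)
    · rw [hG, Set.indicator_of_mem h]
    · rw [hG, Set.indicator_of_notMem h]
      apply hξ
      rw [Set.mem_Icc, ← abs_le, not_le] at h
      rw [abs_mul, abs_of_pos Real.two_pi_pos]
      nlinarith [Real.pi_pos]
  have hGL : MemLp G 2 volume := (Lp.memLp F).indicator measurableSet_Icc
  have hGi : Integrable G := by
    rw [hG, integrable_indicator_iff measurableSet_Icc]
    exact ((Lp.memLp F).restrict _).integrable (by norm_num)
  refine ⟨G, hGL, hGi, fun ξ hξ => ?_, ?_⟩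
  · apply Set.indicator_of_notMem
    rw [Set.mem_Icc, ← abs_le, not_le]
    exact hξ
  -- Both sides are continuous, so almost everywhere equality holds at every point, in particular at
  -- the sampling points.
  · refine funext_iff.1 ((Continuous.ae_eq_iff_eq volume
      (continuous_ofReal.comp hg.continuous) (continuous_integral_exp_mul hGi)).1 ?_)
    filter_upwards [ae_eq_integral_exp_mul_fourier f (hGi.congr hFG.symm),
      hg.memLp.coeFn_toLp] with t ht ht'
    rw [Function.comp_apply, ← ht', ht]
    refine integral_congr_ae ?_
    filter_upwards [hFG] with ξ hξ
    rw [hξ]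

theorem exp_two_pi_add (ξ s t : ℝ) : cexp (2 * Real.pi * (ξ * (s + t) : ℝ) * I) =
    cexp (2 * Real.pi * (ξ * s : ℝ) * I) * cexp (2 * Real.pi * (ξ * t : ℝ) * I) := by
  rw [← Complex.exp_add]
  congr 1
  push_cast
  ring

theorem integrable_exp_mul {G : ℝ → ℂ} (hG : Integrable G) (t : ℝ) :
    Integrable fun ξ : ℝ => cexp (2 * Real.pi * (ξ * t : ℝ) * I) * G ξ :=
  hG.bdd_mul (c := 1) (Continuous.aestronglyMeasurable (by fun_prop))
    (.of_forall fun ξ => (norm_exp_two_pi_mul_I _).le)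

/-! ### Bernstein's inequality and decay of the differences -/

theorem HasSpectrum.sub_translate {G f : ℝ → ℂ} (hf : HasSpectrum G f) (h : ℝ) :
    HasSpectrum (fun ξ => cexp (2 * Real.pi * (ξ * h : ℝ) * I) * G ξ - G ξ)
      (fun t => f (t + h) - f t) := by
  obtain ⟨hG, h0, hf⟩ := hf
  refine ⟨(integrable_exp_mul hG h).sub hG, fun ξ hξ => by simp [h0 ξ hξ], fun t => ?_⟩
  simp only [hf]
  rw [← integral_sub (integrable_exp_mul hG _) (integrable_exp_mul hG _)]
  congr 1
  funext ξ
  rw [exp_two_pi_add]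
  ring

theorem HasSpectrum.hasDerivAt {G f : ℝ → ℂ} (hf : HasSpectrum G f) (t : ℝ) :
    HasDerivAt f (∫ ξ : ℝ, 2 * Real.pi * I * ξ *
      (cexp (2 * Real.pi * (ξ * t : ℝ) * I) * G ξ)) t := by
  obtain ⟨hG, h0, hf⟩ := hf
  have : f = fun t : ℝ => ∫ ξ : ℝ, cexp (2 * Real.pi * (ξ * t : ℝ) * I) * G ξ := funext hf
  rw [this]
  refine (hasDerivAt_integral_of_dominated_loc_of_deriv_le (bound := fun ξ => Real.pi * ‖G ξ‖)
    (F := fun (t ξ : ℝ) => cexp (2 * Real.pi * (ξ * t : ℝ) * I) * G ξ)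
    (F' := fun (t ξ : ℝ) => 2 * Real.pi * I * ξ * (cexp (2 * Real.pi * (ξ * t : ℝ) * I) * G ξ))
    (x₀ := t) (s := Set.univ) univ_mem ?_ ?_ ?_ ?_ ?_ ?_).2
  · exact .of_forall fun s => (integrable_exp_mul hG s).aestronglyMeasurable
  · exact integrable_exp_mul hG t
  · exact (Continuous.aestronglyMeasurable (by fun_prop)).mul
      (integrable_exp_mul hG t).aestronglyMeasurable
  · refine .of_forall fun ξ s _ => ?_
    rw [norm_mul, norm_mul (cexp _), norm_exp_two_pi_mul_I, one_mul]
    by_cases hξ : 1 / 2 < |ξ|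
    · simp [h0 ξ hξ]
    · refine mul_le_mul_of_nonneg_right ?_ (norm_nonneg _)
      have : ‖2 * Real.pi * I * (ξ : ℂ)‖ = 2 * Real.pi * |ξ| := by
        simp [abs_of_pos Real.pi_pos]
      rw [this]
      nlinarith [Real.pi_pos]
  · exact hG.norm.const_mul _
  · refine .of_forall fun ξ s _ => ?_
    have h1 : HasDerivAt (fun s : ℝ => (2 * Real.pi * (ξ * s : ℝ) * I : ℂ))
        (2 * Real.pi * I * ξ) s := by
      have := ((hasDerivAt_id s).ofReal_comp).const_mul (2 * Real.pi * I * ξ : ℂ)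
      convert! this using 1
      · funext s; push_cast; simp only [id]; ring
      · simp
    convert! (h1.cexp.mul_const (G ξ)) using 1
    ring

/-- **Bernstein's inequality**, integrated form. -/
theorem HasSpectrum.norm_sub_le {G f : ℝ → ℂ} (hf : HasSpectrum G f) {M : ℝ}
    (hM : ∀ t, ‖f t‖ ≤ M) (t h : ℝ) : ‖f (t + h) - f t‖ ≤ Real.pi * M * |h| := by
  have hM0 : 0 ≤ M := (norm_nonneg _).trans (hM 0)
  have key : ∀ t, ‖∫ ξ : ℝ, 2 * Real.pi * I * ξ *
      (cexp (2 * Real.pi * (ξ * t : ℝ) * I) * G ξ)‖ ≤ Real.pi * M := by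
    intro t
    obtain ⟨hG, h0, hf⟩ := hf
    set c : ℕ → ℝ := fun n => (1 - (-1) ^ n) / (n : ℝ) ^ 2 with hc
    have hc0 : ∀ n, 0 ≤ c n := riesz_coeff_nonneg
    set F : ℕ → ℝ → ℂ := fun n ξ => ((c n * Real.cos (Real.pi * n / 2 - Real.pi * n * ξ) : ℝ) : ℂ) *
      (cexp (2 * Real.pi * (ξ * t : ℝ) * I) * G ξ) with hF
    have hFi : ∀ n, Integrable (F n) := fun n =>
      (integrable_exp_mul hG t).bdd_mul (c := c n) (Continuous.aestronglyMeasurable (by fun_prop))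
        (.of_forall fun ξ => by
          rw [Complex.norm_real, norm_mul, Real.norm_of_nonneg (hc0 n)]
          exact mul_le_of_le_one_right (hc0 n) (Real.abs_cos_le_one _))
    have hFb : ∀ n, ‖∫ ξ, F n ξ‖ ≤ c n * M := by
      intro n
      -- Each exponential half of the cosine shifts t by ∓n/2, so the term is c_n times the mean of
      -- two values of f with unimodular weights.
      have e : ∫ ξ, F n ξ = c n * (1 / 2 * (cexp (Real.pi * n / 2 * I) * f (t + -n / 2) +
          cexp (-(Real.pi * n / 2 * I)) * f (t + n / 2))) := by
        rw [hf, hf, ← integral_const_mul, ← integral_const_mul, ← integral_add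
          ((integrable_exp_mul hG _).const_mul _) ((integrable_exp_mul hG _).const_mul _),
          ← integral_const_mul, ← integral_const_mul]
        congr 1
        funext ξ
        rw [hF]
        simp only [exp_two_pi_add]
        push_cast
        rw [Complex.cos]
        have e1 : cexp ((Real.pi * n / 2 - Real.pi * n * ξ) * I) =
            cexp (Real.pi * n / 2 * I) * cexp (2 * Real.pi * (ξ * (-n / 2)) * I) := by
          rw [← Complex.exp_add]; congr 1; ring
        have e2 : cexp (-(Real.pi * n / 2 - Real.pi * n * ξ) * I) =
            cexp (-(Real.pi * n / 2 * I)) * cexp (2 * Real.pi * (ξ * (n / 2)) * I) := by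
          rw [← Complex.exp_add]; congr 1; ring
        rw [e1, e2]
        ring
      rw [e, norm_mul, Complex.norm_real, Real.norm_of_nonneg (hc0 n)]
      refine mul_le_mul_of_nonneg_left ?_ (hc0 n)
      have n1 : ‖cexp (Real.pi * n / 2 * I)‖ = 1 := by
        have := norm_exp_ofReal_mul_I (Real.pi * n / 2)
        push_cast at this; exact this
      have n2 : ‖cexp (-(Real.pi * n / 2 * I))‖ = 1 := by
        rw [Complex.exp_neg, norm_inv, n1, inv_one]
      rw [norm_mul]
      have := norm_add_le (cexp (Real.pi * n / 2 * I) * f (t + -n / 2))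
        (cexp (-(Real.pi * n / 2 * I)) * f (t + n / 2))
      rw [norm_mul, norm_mul, n1, n2] at this
      have h1 := hM (t + -n / 2)
      have h2 := hM (t + n / 2)
      have : ‖(1 / 2 : ℂ)‖ = 1 / 2 := by norm_num
      rw [this]
      linarith
    have hsum : HasSum (fun n => ∫ ξ, F n ξ)
        (∫ ξ : ℝ, ((Real.pi ^ 2 / 2 * ξ : ℝ) : ℂ) *
          (cexp (2 * Real.pi * (ξ * t : ℝ) * I) * G ξ)) := by
      have hb := hasSum_riesz_coeff.summable
      refine hasSum_integral_of_dominated_convergence (fun n ξ => c n * ‖G ξ‖)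
        (fun n => (hFi n).aestronglyMeasurable) (fun n => .of_forall fun ξ => ?_)
        (.of_forall fun ξ => hb.mul_right _) ?_ (.of_forall fun ξ => ?_)
      · rw [hF]
        simp only
        rw [norm_mul, norm_mul (cexp _), norm_exp_two_pi_mul_I, one_mul]
        refine mul_le_mul_of_nonneg_right ?_ (norm_nonneg _)
        rw [Complex.norm_real, norm_mul, Real.norm_of_nonneg (hc0 n)]
        exact mul_le_of_le_one_right (hc0 n) (Real.abs_cos_le_one _)
      · simp_rw [tsum_mul_right]
        exact hG.norm.const_mul _
      · by_cases hξ : 1 / 2 < |ξ|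
        · simp [hF, h0 ξ hξ]
        · exact (Complex.hasSum_ofReal.2 (hasSum_riesz (not_lt.1 hξ))).mul_right _
    have hle := tsum_of_norm_bounded (hasSum_riesz_coeff.mul_right M) hFb
    rw [hsum.tsum_eq] at hle
    -- 2πiξ = (4i/π)(π²ξ/2); since the c_n sum to π²/4, the bound is (4/π)(π²/4)M = πM.
    have e : ∫ ξ : ℝ, 2 * Real.pi * I * ξ * (cexp (2 * Real.pi * (ξ * t : ℝ) * I) * G ξ) =
        ((4 / Real.pi : ℝ) : ℂ) * I * ∫ ξ : ℝ, ((Real.pi ^ 2 / 2 * ξ : ℝ) : ℂ) *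
          (cexp (2 * Real.pi * (ξ * t : ℝ) * I) * G ξ) := by
      rw [← integral_const_mul]
      congr 1
      funext ξ
      have : (Real.pi : ℂ) ≠ 0 := by exact_mod_cast Real.pi_ne_zero
      push_cast
      field_simp
      ring
    rw [e, norm_mul, norm_mul, Complex.norm_I, mul_one, Complex.norm_real,
      Real.norm_of_nonneg (by positivity)]
    calc _ ≤ 4 / Real.pi * (Real.pi ^ 2 / 4 * M) := by gcongr
      _ = _ := by field_simp
  have := Convex.norm_image_sub_le_of_norm_hasDerivWithin_le (s := Set.univ)
    (fun x _ => (hf.hasDerivAt x).hasDerivWithinAt) (fun x _ => key x) convex_univ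
    (Set.mem_univ t) (Set.mem_univ (t + h))
  simpa using this

/-- A difference f(· + T) - f again has spectrum in the band and is bounded by πTM, so the Bernstein
bound can be iterated. -/
theorem HasSpectrum.norm_iterate_fwdDiff_le {G f : ℝ → ℂ} (hf : HasSpectrum G f) {M T : ℝ}
    (hT : 0 ≤ T) (hM : ∀ t, ‖f t‖ ≤ M) (n : ℕ) (t : ℝ) :
    ‖(fwdDiff T)^[n] f t‖ ≤ (Real.pi * T) ^ n * M := by
  induction n generalizing f G M with
  | zero => simpa using hM t
  | succ n ih =>
    rw [Function.iterate_succ_apply]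
    refine (ih (hf.sub_translate T) (M := Real.pi * M * T) fun t => ?_).trans_eq (by ring)
    simpa [abs_of_nonneg hT] using hf.norm_sub_le hM t T

theorem iterate_fwdDiff_samples (g : ℝ → ℝ) (T : ℝ) (n : ℕ) (k : ℤ) :
    (((fwdDiff (1 : ℤ))^[n] (fun k : ℤ => g (k * T)) k : ℝ) : ℂ) =
      (fwdDiff T)^[n] (fun t => (g t : ℂ)) (k * T) := by
  induction n generalizing k with
  | zero => rfl
  | succ n ih =>
    rw [Function.iterate_succ_apply', Function.iterate_succ_apply', fwdDiff, fwdDiff,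
      Complex.ofReal_sub, ih, ih]
    push_cast
    rw [add_mul, one_mul]

theorem HasSpectrum.abs_iterate_fwdDiff_samples_le {G : ℝ → ℂ} {g : ℝ → ℝ}
    (hg : HasSpectrum G fun t => (g t : ℂ)) {M T : ℝ} (hT : 0 ≤ T) (hM : ∀ t, |g t| ≤ M)
    (n : ℕ) (k : ℤ) :
    |(fwdDiff (1 : ℤ))^[n] (fun k : ℤ => g (k * T)) k| ≤ (Real.pi * T) ^ n * M := by
  have := hg.norm_iterate_fwdDiff_le hT (M := M) (fun t => by simpa using hM t) n (k * T)
  rwa [← iterate_fwdDiff_samples, Complex.norm_real] at this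

/-! ### Parseval and reconstruction from samples -/

theorem hasSum_conj_fourierCoeffOn_mul {a b : ℝ} {f g : ℝ → ℂ} (hab : a < b)
    (hf : MemLp f 2 (volume.restrict (Set.Ioc a b)))
    (hg : MemLp g 2 (volume.restrict (Set.Ioc a b))) :
    HasSum (fun i => starRingEnd ℂ (fourierCoeffOn hab f i) * fourierCoeffOn hab g i)
      ((b - a)⁻¹ • ∫ x in a..b, starRingEnd ℂ (f x) * g x) := by
  have := Fact.mk (by linarith : 0 < b - a)
  rw [← add_sub_cancel a b] at hf hg
  have hf' := hf.memLp_liftIoc.haarAddCircle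
  have hg' := hg.memLp_liftIoc.haarAddCircle
  have h := (fourierBasis (T := b - a)).hasSum_inner_mul_inner hf'.toLp hg'.toLp
  convert! h using 1
  · funext i
    rw [← inner_conj_symm hf'.toLp, ← HilbertBasis.repr_apply_apply,
      ← HilbertBasis.repr_apply_apply, fourierBasis_repr, fourierBasis_repr,
      fourierCoeff_congr_ae hf'.coeFn_toLp, fourierCoeff_congr_ae hg'.coeFn_toLp,
      fourierCoeff_liftIoc_eq, fourierCoeff_liftIoc_eq]
    simp
  · nth_rw 2 [← add_sub_cancel a b]
    rw [← AddCircle.integral_liftIoc_eq_intervalIntegral, ← AddCircle.integral_haarAddCircle,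
      MeasureTheory.L2.inner_def]
    apply integral_congr_ae
    filter_upwards [hf'.coeFn_toLp, hg'.coeFn_toLp] with x hx hx'
    rw [hx, hx', RCLike.inner_apply']
    rfl

theorem tendsto_fourierCoeffOn_zero {a b : ℝ} {f : ℝ → ℂ} (hab : a < b)
    (hf : MemLp f 2 (volume.restrict (Set.Ioc a b))) :
    Tendsto (fourierCoeffOn hab f) cofinite (𝓝 0) := by
  have h := (hasSum_sq_fourierCoeffOn hab hf).summable.tendsto_cofinite_zero
  rw [tendsto_zero_iff_norm_tendsto_zero]
  have := h.sqrt
  simpa [Real.sqrt_sq (norm_nonneg _)] using this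

/-- The exponential `ξ ↦ exp (2πiξt)` truncated to `[-W, W]`. -/
noncomputable def truncExp (W t : ℝ) : ℝ → ℂ :=
  (Set.Icc (-W) W).indicator fun ξ => cexp (2 * Real.pi * (ξ * t : ℝ) * I)

theorem integral_exp_eq_sinc (W u : ℝ) :
    ∫ ξ in -W..W, cexp (2 * Real.pi * (ξ * u : ℝ) * I) =
      ((2 * W * Real.sinc (2 * Real.pi * W * u) : ℝ) : ℂ) := by
  by_cases hu : u = 0
  · simp [hu]
    ring
  · by_cases hW : W = 0
    · simp [hW]
    have hne : 2 * Real.pi * u * I ≠ (0 : ℂ) := by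
      simp [hu, Real.pi_ne_zero]
    have h := integral_exp_mul_complex (a := -W) (b := W) hne
    have e : ∀ ξ : ℝ, (2 * Real.pi * (ξ * u : ℝ) * I : ℂ) = 2 * Real.pi * u * I * ξ := by
      intro ξ; push_cast; ring
    simp_rw [e]
    rw [h, Real.sinc_of_ne_zero (by simp [hu, hW, Real.pi_ne_zero])]
    push_cast
    rw [Complex.sin]
    have e1 : (2 * Real.pi * u * I * W : ℂ) = 2 * Real.pi * W * u * I := by ring
    have e2 : (2 * Real.pi * u * I * -W : ℂ) = -(2 * Real.pi * W * u) * I := by ring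
    have : (Real.pi : ℂ) ≠ 0 := by exact_mod_cast Real.pi_ne_zero
    have : (W : ℂ) ≠ 0 := by exact_mod_cast hW
    have : (u : ℂ) ≠ 0 := by exact_mod_cast hu
    rw [e1, e2]
    field_simp
    simp only [I_sq]
    ring

theorem aestronglyMeasurable_truncExp (W t : ℝ) (μ : Measure ℝ) :
    AEStronglyMeasurable (truncExp W t) μ :=
  (Continuous.aestronglyMeasurable (by fun_prop)).indicator measurableSet_Icc

theorem norm_truncExp_le (W t ξ : ℝ) : ‖truncExp W t ξ‖ ≤ 1 :=
  (norm_indicator_le_norm_self _ _).trans (norm_exp_two_pi_mul_I _).le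

theorem memLp_truncExp (W t : ℝ) (a b : ℝ) :
    MemLp (truncExp W t) 2 (volume.restrict (Set.Ioc a b)) :=
  MemLp.of_bound (aestronglyMeasurable_truncExp W t _) 1 (.of_forall (norm_truncExp_le W t))

theorem intervalIntegral_truncExp_mul {W c t : ℝ} (hW : 0 ≤ W) (hc : W ≤ c) (f : ℝ → ℂ) :
    ∫ ξ in -c..c, truncExp W t ξ * f ξ =
      ∫ ξ in -W..W, cexp (2 * Real.pi * (ξ * t : ℝ) * I) * f ξ := by
  have e : ∀ ξ, truncExp W t ξ * f ξ =
      (Set.Icc (-W) W).indicator (fun ξ => cexp (2 * Real.pi * (ξ * t : ℝ) * I) * f ξ) ξ := by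
    intro ξ
    rw [truncExp, Set.indicator_mul_left]
  simp_rw [e]
  rw [intervalIntegral.integral_of_le (by linarith), intervalIntegral.integral_of_le (by linarith),
    ← integral_Icc_eq_integral_Ioc, ← integral_Icc_eq_integral_Ioc,
    setIntegral_indicator measurableSet_Icc,
    Set.inter_eq_self_of_subset_right (Set.Icc_subset_Icc (by linarith) hc)]

theorem fourier_neg_coe_apply {L : ℝ} (k : ℤ) (ξ : ℝ) :
    fourier (-k) (ξ : AddCircle L) = cexp (2 * Real.pi * (ξ * (-(k / L)) : ℝ) * I) := by
  rw [fourier_coe_apply]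
  congr 1
  push_cast
  ring

theorem fourierCoeffOn_truncExp {W c t : ℝ} (hc : -c < c) (hW : 0 ≤ W) (hWc : W ≤ c) (k : ℤ) :
    fourierCoeffOn hc (truncExp W t) k =
      ((1 / (c - -c) * (2 * W * Real.sinc (2 * Real.pi * W * (t - k / (c - -c)))) : ℝ) : ℂ) := by
  rw [fourierCoeffOn_eq_integral]
  simp_rw [fourier_neg_coe_apply, smul_eq_mul, mul_comm _ (truncExp W t _)]
  rw [intervalIntegral_truncExp_mul hW hWc, Complex.ofReal_mul, ← integral_exp_eq_sinc,
    Complex.real_smul]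
  simp_rw [← exp_two_pi_add, ← sub_eq_add_neg]

/-- The lowpass filter reproduces bandlimited functions from their samples. -/
theorem HasSpectrum.hasSum_lowPass {G f : ℝ → ℂ} (hf : HasSpectrum G f) (hG : MemLp G 2 volume)
    {T Ω : ℝ} (hT : 0 < T) (hΩ : Real.pi ≤ Ω) (hΩT : Ω ≤ Real.pi / T) (t : ℝ) :
    HasSum (fun k : ℤ => f (k * T) *
      ((T * Ω / Real.pi * Real.sinc (Ω * (t - k * T)) : ℝ) : ℂ)) (f t) := by
  obtain ⟨hGi, h0, hf⟩ := hf
  have hπ := Real.pi_pos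
  -- On one period [-c, c] of length 1/T, the pass band [-W, W] contains the spectrum: 1/2 ≤ W ≤ c.
  set c : ℝ := 1 / (2 * T) with hc
  set W : ℝ := Ω / (2 * Real.pi) with hW
  have hW2 : 1 / 2 ≤ W := by rw [hW, le_div_iff₀ (by positivity)]; linarith
  have hWc : W ≤ c := by
    rw [hW, hc, div_le_div_iff₀ (by positivity) (by positivity)]
    rw [le_div_iff₀ hT] at hΩT
    linarith
  have hcc : -c < c := by linarith
  have hL : c - -c = 1 / T := by rw [hc]; field_simp; ring
  have hint : ∀ {V : ℝ} (_ : 1 / 2 ≤ V) (t : ℝ),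
      ∫ ξ in -V..V, cexp (2 * Real.pi * (ξ * t : ℝ) * I) * G ξ = f t := by
    intro V hV t
    rw [hf, intervalIntegral.integral_of_le (by linarith), ← integral_Icc_eq_integral_Ioc]
    refine setIntegral_eq_integral_of_forall_compl_eq_zero fun ξ hξ => ?_
    rw [Set.mem_Icc, ← abs_le, not_le] at hξ
    rw [h0 ξ (by linarith), mul_zero]
  -- The sign of t compensates the conjugation in Parseval's identity.
  have h := hasSum_conj_fourierCoeffOn_mul hcc (memLp_truncExp W (-t) _ _) (hG.restrict _)
  have hconj : ∀ ξ, starRingEnd ℂ (truncExp W (-t) ξ) = truncExp W t ξ := by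
    intro ξ
    unfold truncExp
    by_cases hξ : ξ ∈ Set.Icc (-W) W
    · rw [Set.indicator_of_mem hξ, Set.indicator_of_mem hξ, ← Complex.exp_conj]
      congr 1
      simp [map_ofNat]
    · rw [Set.indicator_of_notMem hξ, Set.indicator_of_notMem hξ, map_zero]
  simp_rw [hconj] at h
  rw [intervalIntegral_truncExp_mul (by linarith) hWc, hint hW2] at h
  have hG' : ∀ k : ℤ, fourierCoeffOn hcc G k = T * f (-k * T) := by
    intro k
    rw [fourierCoeffOn_eq_integral]
    simp_rw [fourier_neg_coe_apply, smul_eq_mul]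
    rw [hint (hW2.trans hWc), hL, Complex.real_smul]
    simp
  simp_rw [hG', fourierCoeffOn_truncExp hcc (by linarith) hWc, Complex.conj_ofReal] at h
  have h' := (h.mul_left (T : ℂ)⁻¹)
  rw [hL, Complex.real_smul] at h'
  -- The k-th Fourier coefficient of G carries the sample at -kT.
  rw [← (Equiv.neg ℤ).hasSum_iff]
  have hTC : (T : ℂ) ≠ 0 := by exact_mod_cast hT.ne'
  convert! h' using 1
  · funext k
    simp only [Function.comp_apply, Equiv.neg_apply, Int.cast_neg]
    have e : Ω * (t - -k * T) = -(2 * Real.pi * W * (-t - k / (1 / T))) := by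
      rw [hW]; field_simp; ring
    rw [e, Real.sinc_neg, hW]
    push_cast
    field_simp
  · push_cast
    field_simp

/-! ### The low-pass filter on constants -/

theorem norm_exp_two_pi_sub_one (x : ℝ) :
    ‖cexp (2 * Real.pi * (x : ℝ) * I) - 1‖ = 2 * |Real.sin (Real.pi * x)| := by
  have := Complex.norm_exp_I_mul_ofReal_sub_one (2 * Real.pi * x)
  rw [show (2 * Real.pi * x / 2 : ℝ) = Real.pi * x by ring, norm_mul] at this
  rw [show (2 * Real.pi * (x : ℝ) * I : ℂ) = I * ((2 * Real.pi * x : ℝ) : ℂ) by push_cast; ring,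
    this]
  simp

theorem le_norm_exp_two_pi_sub_one {x : ℝ} (hx : |x| ≤ 1 / 2) :
    4 * |x| ≤ ‖cexp (2 * Real.pi * (x : ℝ) * I) - 1‖ := by
  have hπ := Real.pi_pos
  rw [norm_exp_two_pi_sub_one]
  have := Real.mul_abs_le_abs_sin (x := Real.pi * x) (by
    rw [abs_mul, abs_of_pos hπ]; nlinarith)
  rw [abs_mul, abs_of_pos hπ] at this
  have e : 2 / Real.pi * (Real.pi * |x|) = 2 * |x| := by field_simp
  linarith

/-- On the period the denominator is at least 4T|ξ|, vanishing only at 0. There the numerator is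
O(|ξ|), because 0 is interior to the pass band, so the quotient is bounded. -/
theorem memLp_truncExp_sub_one_div {W c T t : ℝ} (hW : 0 < W) (hT : 0 < T)
    (hc : c = 1 / (2 * T)) :
    MemLp (fun ξ : ℝ => (truncExp W t ξ - 1) / (cexp (2 * Real.pi * (ξ * T : ℝ) * I) - 1)) 2
      (volume.restrict (Set.Ioc (-c) c)) := by
  have hπ := Real.pi_pos
  refine MemLp.of_bound (C := Real.pi * |t| / (2 * T) + 1 / (2 * T * W)) ?_ ?_
  · refine AEMeasurable.aestronglyMeasurable ?_
    refine ((aestronglyMeasurable_truncExp W t _).aemeasurable.sub_const 1).div ?_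
    exact Continuous.aemeasurable (by fun_prop)
  · filter_upwards [ae_restrict_mem measurableSet_Ioc] with ξ hξ
    have hξc : |ξ| ≤ c := abs_le.2 ⟨hξ.1.le, hξ.2⟩
    by_cases hξ0 : ξ = 0
    · subst hξ0
      simp
      positivity
    have hξp : 0 < |ξ| := abs_pos.2 hξ0
    have hden : 4 * T * |ξ| ≤ ‖cexp (2 * Real.pi * (ξ * T : ℝ) * I) - 1‖ := by
      refine le_trans (le_of_eq ?_) (le_norm_exp_two_pi_sub_one ?_)
      · rw [abs_mul, abs_of_pos hT]; ring
      · rw [hc, le_div_iff₀ (by positivity)] at hξc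
        rw [abs_mul, abs_of_pos hT]; linarith
    rw [norm_div]
    have hpos : 0 < 4 * T * |ξ| := by positivity
    refine (div_le_div_of_nonneg_left (norm_nonneg _) hpos hden).trans ?_
    rw [div_le_iff₀ hpos]
    have e : (Real.pi * |t| / (2 * T) + 1 / (2 * T * W)) * (4 * T * |ξ|) =
        2 * Real.pi * |t| * |ξ| + 2 * (|ξ| / W) := by
      field_simp
      ring
    rw [e]
    by_cases hξW : ξ ∈ Set.Icc (-W) W
    · rw [truncExp, Set.indicator_of_mem hξW, norm_exp_two_pi_sub_one]
      have := Real.abs_sin_le_abs (x := Real.pi * (ξ * t))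
      rw [abs_mul, abs_mul, abs_of_pos hπ] at this
      have : 0 ≤ |ξ| / W := by positivity
      linarith
    · rw [truncExp, Set.indicator_of_notMem hξW, zero_sub, norm_neg, norm_one]
      rw [Set.mem_Icc, ← abs_le, not_le] at hξW
      have : 1 ≤ |ξ| / W := by rw [le_div_iff₀ hW]; linarith
      have : 0 ≤ 2 * Real.pi * |t| * |ξ| := by positivity
      linarith

theorem sum_Icc_telescope (q : ℤ → ℂ) (K : ℕ) :
    ∑ k ∈ Finset.Icc (-(K : ℤ)) K, (q (k - 1) - q k) = q (-K - 1) - q K := by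
  induction K with
  | zero => simp
  | succ K ih =>
    have : Finset.Icc (-((K + 1 : ℕ) : ℤ)) ((K + 1 : ℕ) : ℤ) =
        insert (-((K : ℤ) + 1)) (insert ((K : ℤ) + 1) (Finset.Icc (-(K : ℤ)) K)) := by
      ext x
      simp only [Finset.mem_Icc, Finset.mem_insert]
      push_cast
      omega
    rw [this, Finset.sum_insert (by simp; omega), Finset.sum_insert (by simp), ih]
    push_cast
    rw [show -(K : ℤ) - 1 = -((K : ℤ) + 1) by ring, show (K : ℤ) + 1 - 1 = K by ring]
    ring

/-- The lowpass filter reproduces constants. -/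
theorem tendsto_sum_lowPass {T Ω : ℝ} (hT : 0 < T) (hΩ : 0 < Ω) (hΩT : Ω ≤ Real.pi / T) (t : ℝ) :
    Tendsto (fun K : ℕ => ∑ k ∈ Finset.Icc (-(K : ℤ)) K,
      T * Ω / Real.pi * Real.sinc (Ω * (t - k * T))) atTop (𝓝 1) := by
  have hπ := Real.pi_pos
  set c : ℝ := 1 / (2 * T) with hc
  set W : ℝ := Ω / (2 * Real.pi) with hW
  have hW0 : 0 < W := by positivity
  have hWc : W ≤ c := by
    rw [hW, hc, div_le_div_iff₀ (by positivity) (by positivity)]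
    rw [le_div_iff₀ hT] at hΩT
    linarith
  have hcc : -c < c := by linarith
  have hL : c - -c = 1 / T := by rw [hc]; field_simp; ring
  set q : ℝ → ℂ := fun ξ =>
    (truncExp W t ξ - 1) / (cexp (2 * Real.pi * (ξ * T : ℝ) * I) - 1) with hq
  have hqL := memLp_truncExp_sub_one_div (t := t) hW0 hT hc
  have hqI : IntervalIntegrable q volume (-c) c :=
    (intervalIntegrable_iff_integrableOn_Ioc_of_le hcc.le).2 (hqL.integrable (by norm_num))
  -- At ξ = 0 the quotient is 0 by convention and both sides equal 1.
  have hpq : ∀ ξ ∈ Set.uIoc (-c) c, truncExp W t ξ =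
      1 + (cexp (2 * Real.pi * (ξ * T : ℝ) * I) * q ξ - q ξ) := by
    intro ξ hξ
    rw [Set.uIoc_of_le hcc.le] at hξ
    by_cases hξ0 : ξ = 0
    · subst hξ0
      simp [truncExp, hW0.le]
    have hξc : |ξ| ≤ c := abs_le.2 ⟨hξ.1.le, hξ.2⟩
    have hne : cexp (2 * Real.pi * (ξ * T : ℝ) * I) - 1 ≠ 0 := by
      refine norm_pos_iff.1 (lt_of_lt_of_le ?_ (le_norm_exp_two_pi_sub_one ?_))
      · have : ξ * T ≠ 0 := mul_ne_zero hξ0 hT.ne'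
        positivity
      · rw [hc, le_div_iff₀ (by positivity)] at hξc
        rw [abs_mul, abs_of_pos hT]; linarith
    rw [hq]
    field_simp
    ring
  -- Multiplication by exp(2πiξT) shifts the Fourier index by one on a period of length 1/T, so the
  -- symmetric sums telescope to 1 plus two coefficients of q, which tend to 0.
  have hcoeff : ∀ k : ℤ, fourierCoeffOn hcc (truncExp W t) k =
      (if k = 0 then 1 else 0) + (fourierCoeffOn hcc q (k - 1) - fourierCoeffOn hcc q k) := by
    intro k
    have hone : (1 / (c - -c)) • ∫ ξ in -c..c, cexp (2 * Real.pi * (ξ * (-(k * T)) : ℝ) * I) =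
        if k = 0 then (1 : ℂ) else 0 := by
      rw [integral_exp_eq_sinc, hL, Complex.real_smul,
        show 2 * Real.pi * c * (-(k * T)) = -(k * Real.pi) by rw [hc]; field_simp, Real.sinc_neg]
      split_ifs with hk
      · subst hk
        rw [← Complex.ofReal_mul, hc, Int.cast_zero, zero_mul, Real.sinc_zero]
        norm_cast
        field_simp
      · rw [Real.sinc_of_ne_zero (by simp [hk, Real.pi_ne_zero]), Real.sin_int_mul_pi]
        simp
    have hint : ∀ j : ℤ, IntervalIntegrable
        (fun ξ => cexp (2 * Real.pi * (ξ * (-(j * T)) : ℝ) * I) * q ξ) volume (-c) c := fun j =>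
      hqI.continuousOn_mul (Continuous.continuousOn (by fun_prop))
    simp only [fourierCoeffOn_eq_integral, fourier_neg_coe_apply, smul_eq_mul]
    rw [← hone, ← smul_sub, ← smul_add]
    simp only [hL, div_div_eq_mul_div, div_one]
    rw [← intervalIntegral.integral_sub (hint _) (hint _),
      ← intervalIntegral.integral_add (Continuous.intervalIntegrable (by fun_prop) _ _)
        ((hint _).sub (hint _))]
    congr 1
    refine intervalIntegral.integral_congr_ae (.of_forall fun ξ hξ => ?_)
    rw [hpq ξ hξ]
    have e : cexp (2 * Real.pi * (ξ * (-((k - 1 : ℤ) * T)) : ℝ) * I) =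
        cexp (2 * Real.pi * (ξ * (-(k * T)) : ℝ) * I) *
          cexp (2 * Real.pi * (ξ * T : ℝ) * I) := by
      rw [← exp_two_pi_add]
      congr 5
      push_cast
      ring
    rw [e]
    ring
  have hval : ∀ k : ℤ, fourierCoeffOn hcc (truncExp W t) k =
      ((T * Ω / Real.pi * Real.sinc (Ω * (t - k * T)) : ℝ) : ℂ) := by
    intro k
    rw [fourierCoeffOn_truncExp hcc hW0.le hWc, hL]
    congr 1
    rw [show 2 * Real.pi * W = Ω by rw [hW]; field_simp, hW]
    simp
    field_simp
  have hsum : ∀ K : ℕ, ((∑ k ∈ Finset.Icc (-(K : ℤ)) K,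
      T * Ω / Real.pi * Real.sinc (Ω * (t - k * T)) : ℝ) : ℂ) =
      1 + (fourierCoeffOn hcc q (-K - 1) - fourierCoeffOn hcc q K) := by
    intro K
    rw [Complex.ofReal_sum]
    simp_rw [← hval, hcoeff]
    rw [Finset.sum_add_distrib, sum_Icc_telescope, Finset.sum_ite_eq' ]
    simp
  have hz := tendsto_fourierCoeffOn_zero hcc hqL
  have h1 : Tendsto (fun K : ℕ => (-(K : ℤ) - 1)) atTop cofinite := by
    rw [← Nat.cofinite_eq_atTop]
    exact Function.Injective.tendsto_cofinite fun a b h => by simpa using h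
  have h2 : Tendsto (fun K : ℕ => (K : ℤ)) atTop cofinite := by
    rw [← Nat.cofinite_eq_atTop]
    exact Function.Injective.tendsto_cofinite fun a b h => by simpa using h
  have h3 := ((hz.comp h1).sub (hz.comp h2)).const_add 1
  rw [sub_zero, add_zero] at h3
  have h4 := (Complex.continuous_re.tendsto _).comp h3
  rw [Complex.one_re] at h4
  refine h4.congr fun K => ?_
  simp only [Function.comp_apply]
  rw [← hsum, Complex.ofReal_re]

end Spectrum

/-! ### Choice of N and assembly -/

theorem IsBandlimited.exists_bound {g : ℝ → ℝ} (hg : IsBandlimited Real.pi g) :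
    ∃ C : ℝ, ∀ t, |g t| ≤ C := by
  obtain ⟨G, -, -, -, h⟩ := hg.exists_hasSpectrum
  refine ⟨∫ ξ, ‖G ξ‖, fun t => ?_⟩
  rw [← Real.norm_eq_abs, ← Complex.norm_real, show (g t : ℂ) = _ from h t]
  refine (norm_integral_le_integral_norm _).trans_eq (integral_congr_ae (.of_forall fun ξ => ?_))
  simp only [norm_mul, norm_exp_two_pi_mul_I, one_mul]

theorem supNorm_le_ofReal_iff {g : ℝ → ℝ} {C : ℝ} (hC : 0 ≤ C) :
    supNorm g ≤ ENNReal.ofReal C ↔ ∀ t, |g t| ≤ C := by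
  unfold supNorm
  rw [iSup_le_iff]
  refine forall_congr' fun t => ?_
  rw [← ofReal_norm, ENNReal.ofReal_le_ofReal_iff hC, Real.norm_eq_abs]

theorem IsBandlimited.isLowPassOutput {g : ℝ → ℝ} (hg : IsBandlimited Real.pi g) {T Ω : ℝ}
    (hT : 0 < T) (hΩ : Real.pi ≤ Ω) (hΩT : Ω ≤ Real.pi / T) {a : ℤ → ℝ} {C : ℝ}
    (ha : ∀ k : ℤ, a k = g (k * T) + C) :
    IsLowPassOutput T Ω a fun t => g t + C := by
  intro t
  obtain ⟨G, hG2, hG⟩ := hg.exists_hasSpectrum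
  have h1 := hG.hasSum_lowPass hG2 hT hΩ hΩT t
  have h2 : HasSum (fun k : ℤ => g (k * T) *
      (T * Ω / Real.pi * Real.sinc (Ω * (t - k * T)))) (g t) := by
    rw [← Complex.hasSum_ofReal]
    simpa using h1
  have h3 := (h2.comp Finset.tendsto_Icc_neg).add
    ((tendsto_sum_lowPass hT (Real.pi_pos.trans_le hΩ) hΩT t).const_mul C)
  rw [mul_one] at h3
  refine h3.congr fun K => ?_
  simp only [Function.comp_apply]
  rw [Finset.mul_sum, ← Finset.sum_add_distrib]
  refine Finset.sum_congr rfl fun k _ => ?_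
  rw [ha]
  ring

theorem mul_pi_mul_exp_one_le_half {T : ℝ} (hT' : T ≤ 1 / (2 * Real.pi * Real.exp 1)) :
    T * Real.pi * Real.exp 1 ≤ 1 / 2 := by
  have hπ := Real.pi_pos
  have he := Real.exp_pos 1
  rw [le_div_iff₀ (by positivity)] at hT'
  linarith

theorem pow_mul_le_of_ceil_le {r lam beta : ℝ} (hlam : 0 < lam) (hbeta : 0 < beta) (hr : 0 < r)
    (hr1 : r < 1) {n : ℕ}
    (hn : ⌈(Real.log lam - Real.log beta) / Real.log r⌉₊ ≤ n) : r ^ n * beta ≤ lam := by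
  have hlog : Real.log r < 0 := Real.log_neg hr hr1
  have h := Nat.ceil_le.1 hn
  rw [div_le_iff_of_neg hlog] at h
  rw [← Real.log_le_log_iff (by positivity) hlam, Real.log_mul (by positivity) hbeta.ne',
    Real.log_pow]
  linarith

theorem lt_pow_mul_of_lt_ceil {r lam beta : ℝ} (hlam : 0 < lam) (hbeta : 0 < beta) (hr : 0 < r)
    (hr1 : r < 1) {n : ℕ}
    (hn : n < ⌈(Real.log lam - Real.log beta) / Real.log r⌉₊) : lam < r ^ n * beta := by
  have hlog : Real.log r < 0 := Real.log_neg hr hr1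
  have h := Nat.lt_ceil.1 hn
  rw [lt_div_iff_of_neg hlog] at h
  rw [← Real.log_lt_log_iff hlam (by positivity), Real.log_mul (by positivity) hbeta.ne',
    Real.log_pow]
  linarith

/-- Recovery of bandlimited functions from modulo samples by the algorithm. -/
theorem IsBandlimited.exists_recoveredSamples_eq {g : ℝ → ℝ} (hg : IsBandlimited Real.pi g)
    {lam T beta : ℝ} (hlam : 0 < lam) (hT : 0 < T) (hT' : T ≤ 1 / (2 * Real.pi * Real.exp 1)) (hbeta : 0 < beta)
    (hb : ∃ b : ℤ, beta = 2 * lam * b) (hgb : ∀ t, |g t| ≤ beta) :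
    ∃ m : ℤ, ∀ k : ℤ, recoveredSamples lam beta
      ⌈(Real.log lam - Real.log beta) / Real.log (T * Real.pi * Real.exp 1)⌉₊
      (moduloSamples lam T g) k = g (k * T) + 2 * lam * m := by
  obtain ⟨b, hb⟩ := hb
  have hπ := Real.pi_pos
  have he := Real.exp_pos 1
  have hr : 0 < T * Real.pi * Real.exp 1 := by positivity
  have hr2 := mul_pi_mul_exp_one_le_half hT'
  have hr1 : T * Real.pi * Real.exp 1 < 1 := by linarith
  have hlt : Real.pi * T < T * Real.pi * Real.exp 1 := by
    have : 1 < Real.exp 1 := Real.one_lt_exp_iff.2 one_pos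
    nlinarith [mul_pos hT hπ]
  have hπT1 : Real.pi * T ≤ 1 := by linarith
  set N := ⌈(Real.log lam - Real.log beta) / Real.log (T * Real.pi * Real.exp 1)⌉₊ with hN
  have hbpos : (1 : ℝ) ≤ b := by
    have : (0 : ℝ) < b := by
      rw [hb] at hbeta
      exact pos_of_mul_pos_right hbeta (by positivity)
    exact_mod_cast this
  -- N = 0 would give β ≤ λ, contradicting β ≥ 2λ.
  have hN1 : 1 ≤ N := by
    by_contra h0
    have h := pow_mul_le_of_ceil_le hlam hbeta hr hr1 hN.ge
    rw [show N = 0 by omega, pow_zero, one_mul, hb] at h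
    nlinarith
  have hNle := pow_mul_le_of_ceil_le hlam hbeta hr hr1 hN.ge
  -- Minimality of N: λ < (Tπe)^(N-1) β ≤ 2^(-(N-1)) β. Here Tπe ≤ 1/2 is used to control the
  -- differences of y.
  have hNlt := lt_pow_mul_of_lt_ceil (n := N - 1) hlam hbeta hr hr1 (by omega)
  obtain ⟨G, -, hG⟩ := hg.exists_hasSpectrum
  have hd := fun n k => hG.abs_iterate_fwdDiff_samples_le hT.le hgb n k
  refine UnlimitedSampling.exists_recoveredSamples_eq hlam hbeta hb hN1 ?_
    (fun k : ℤ => g (k * T)) (fun n k => (hd n k).trans ?_) fun k => (hd N k).trans_lt ?_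
  · have h1 : (T * Real.pi * Real.exp 1) ^ (N - 1) ≤ (1 / 2) ^ (N - 1) :=
      pow_le_pow_left₀ hr.le hr2 _
    have h2 : lam ≤ (1 / 2) ^ (N - 1) * beta := hNlt.le.trans (by gcongr)
    calc (2 : ℝ) ^ (N - 1) * lam ≤ 2 ^ (N - 1) * ((1 / 2) ^ (N - 1) * beta) := by gcongr
      _ = beta := by rw [← mul_assoc, ← mul_pow]; norm_num
  · exact mul_le_of_le_one_left hbeta.le (pow_le_one₀ (by positivity) hπT1)
  · refine lt_of_lt_of_le ?_ hNle
    gcongr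

end UnlimitedSampling

theorem mainTheorem1 (lam T : ℝ) (hlam : 0 < lam) (hT : 0 < T)
    (hT' : T ≤ 1 / (2 * Real.pi * Real.exp 1)) :
    (∃ R : (ℤ → ℝ) → (ℝ → ℝ), ∀ g : ℝ → ℝ, UnlimitedSampling.IsBandlimited Real.pi g →
      ∃ m : ℤ, ∀ t : ℝ, R (UnlimitedSampling.moduloSamples lam T g) t = g t + 2 * lam * m) ∧
    (∀ (g : ℝ → ℝ) (beta : ℝ) (N : ℕ), UnlimitedSampling.IsBandlimited Real.pi g →
      0 < beta → (∃ b : ℤ, beta = 2 * lam * b) → UnlimitedSampling.supNorm g ≤ ENNReal.ofReal beta →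
      N = ⌈(Real.log lam - Real.log beta) / Real.log (T * Real.pi * Real.exp 1)⌉₊ →
      (ENNReal.ofReal ((T * Real.pi * Real.exp 1) ^ N) * UnlimitedSampling.supNorm g ≤ ENNReal.ofReal lam ∧
        (¬ (UnlimitedSampling.supNorm g = ENNReal.ofReal beta ∧ (T * Real.pi * Real.exp 1) ^ N * beta = lam) →
          ENNReal.ofReal ((T * Real.pi * Real.exp 1) ^ N) * UnlimitedSampling.supNorm g < ENNReal.ofReal lam)) ∧
      ∃ m : ℤ,
        (∀ k : ℤ, UnlimitedSampling.recoveredSamples lam beta N (UnlimitedSampling.moduloSamples lam T g) k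
          = g (k * T) + 2 * lam * m) ∧
        ∀ Ω : ℝ, Real.pi ≤ Ω → Ω ≤ Real.pi / T →
          UnlimitedSampling.IsLowPassOutput T Ω (UnlimitedSampling.recoveredSamples lam beta N (UnlimitedSampling.moduloSamples lam T g))
            (fun t => g t + 2 * lam * m)) := by
  open UnlimitedSampling in
  have hr : 0 < T * Real.pi * Real.exp 1 := by positivity
  have hr2 := mul_pi_mul_exp_one_le_half hT'
  have hr1 : T * Real.pi * Real.exp 1 < 1 := by linarith
  have hπ := Real.pi_pos
  refine ⟨?_, ?_⟩
  · classical
    refine ⟨fun y => if h : ∃ g, IsBandlimited Real.pi g ∧ moduloSamples lam T g = y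
      then h.choose else 0, fun g hg => ?_⟩
    have h : ∃ f, IsBandlimited Real.pi f ∧ moduloSamples lam T f = moduloSamples lam T g :=
      ⟨g, hg, rfl⟩
    simp only [dif_pos h]
    obtain ⟨hf, hfg⟩ := h.choose_spec
    set f := h.choose
    obtain ⟨C, hC⟩ := hf.exists_bound
    obtain ⟨D, hD⟩ := hg.exists_bound
    obtain ⟨n, hn⟩ := exists_nat_ge (max C D / (2 * lam))
    rw [div_le_iff₀ (by positivity)] at hn
    -- One β dominating both functions, so the same run of the algorithm on the common samples
    -- recovers each of them.
    set beta : ℝ := 2 * lam * ((n + 1 : ℕ) : ℤ) with hbeta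
    have hle : max C D ≤ beta := by
      rw [hbeta]; push_cast; linarith
    have hb0 : 0 < beta := by rw [hbeta]; push_cast; positivity
    obtain ⟨m₁, h₁⟩ := hf.exists_recoveredSamples_eq hlam hT hT' hb0 ⟨_, hbeta⟩
      fun t => (hC t).trans ((le_max_left _ _).trans hle)
    obtain ⟨m₂, h₂⟩ := hg.exists_recoveredSamples_eq hlam hT hT' hb0 ⟨_, hbeta⟩
      fun t => (hD t).trans ((le_max_right _ _).trans hle)
    rw [hfg] at h₁
    have hT1 : Real.pi ≤ Real.pi / T := by
      rw [le_div_iff₀ hT]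
      have : 1 < Real.exp 1 := Real.one_lt_exp_iff.2 one_pos
      have : T < 1 := by nlinarith [Real.pi_gt_three, mul_pos hT hπ]
      nlinarith
    refine ⟨m₂ - m₁, fun t => ?_⟩
    have := tendsto_nhds_unique (hf.isLowPassOutput hT le_rfl hT1 h₁ t)
      (hg.isLowPassOutput hT le_rfl hT1 h₂ t)
    push_cast
    linarith
  · intro g beta N hg hbeta hb hsup hN
    have hNle := pow_mul_le_of_ceil_le hlam hbeta hr hr1 hN.ge
    have hp : 0 < (T * Real.pi * Real.exp 1) ^ N := by positivity
    have hmul : ENNReal.ofReal ((T * Real.pi * Real.exp 1) ^ N) * ENNReal.ofReal beta =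
        ENNReal.ofReal ((T * Real.pi * Real.exp 1) ^ N * beta) :=
      (ENNReal.ofReal_mul hp.le).symm
    have hle : ENNReal.ofReal ((T * Real.pi * Real.exp 1) ^ N) * supNorm g ≤
        ENNReal.ofReal ((T * Real.pi * Real.exp 1) ^ N * beta) := by
      rw [← hmul]
      gcongr
    refine ⟨⟨hle.trans (ENNReal.ofReal_le_ofReal hNle), fun hne => ?_⟩, ?_⟩
    · rcases hsup.lt_or_eq with hlt | heq
      · refine lt_of_lt_of_le ?_ (ENNReal.ofReal_le_ofReal hNle)
        rw [← hmul]
        exact ENNReal.mul_lt_mul_right (by simpa using hp) ENNReal.ofReal_ne_top hlt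
      · exact hle.trans_lt ((ENNReal.ofReal_lt_ofReal_iff hlam).2
          (lt_of_le_of_ne hNle fun h => hne ⟨heq, h⟩))
    · obtain ⟨m, hm⟩ := hg.exists_recoveredSamples_eq hlam hT hT' hbeta hb
        ((supNorm_le_ofReal_iff hbeta.le).1 hsup)
      rw [← hN] at hm
      exact ⟨m, hm, fun Ω hΩ hΩT => hg.isLowPassOutput hT hΩ hΩT hm⟩
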